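/- Let $n\ge 1$ and let $x^{(k)}=\{x^{(k)}_1,x^{(k)}_2,\dots\}$, $y^{(k)}=\{y^{(k)}_1,y^{(k)}_2,\dots\}$ ($1\le k\le n$) be disjoint infinite alphabets. Write $\pmb x^{(k)}=x^{(1)}\cup\dots\cup x^{(k)}$, $\pmb x=\pmb x^{(n)}$, and similarly for $y$. For a multi-partition $\pmb\lambda=(\lambda^{(1)},\dots,\lambda^{(n)})$ put $$m_{\pmb\lambda}=\prod_{k=1}^n m_{\lambda^{(k)}}(x^{(k)}),\qquad p_{\pmb\lambda}(x^{(1)},\dots,x^{(n)})=\prod_{k=1}^n p_{\lambda^{(k)}}(\pmb x^{(k)}),$$ where $m_\lambda$ and $p_\lambda$ are the monomial and power-sum symmetric functions, and $$z_{\pmb\lambda}(q,t)=q^{\sum_k (n-1)|\lambda^{(k)}|-\sum_k (k-1)|\lambda^{(k)}|}\;z_{\lambda^{(1)}}\cdots z_{\lambda^{(n)}}\prod_{i=1}^{\ell(\lambda^{(n)})}\frac{1-q^{\lambda^{(n)}_i}}{1-t^{\lambda^{(n)}_i}},\qquad z_\lambda=\prod_{i\ge1} i^{m_i(\lambda)}m_i(\lambda)!,$$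 with $m_i(\lambda)$ the number of parts of $\lambda$ equal to $i$. On the $\mathbb Q(q,t)$-vector space of multi-symmetric functions, which has the bases $\{m_{\pmb\lambda}\}$ and $\{p_{\pmb\lambda}\}$, let $\langle\!\langle\cdot,\cdot\rangle\!\rangle$ be the bilinear form with $\langle\!\langle p_{\pmb\lambda},p_{\pmb\mu}\rangle\!\rangle=\delta_{\pmb\lambda,\pmb\mu}\,z_{\pmb\lambda}(q,t)$. With $(a;q)_\infty=\prod_{m\ge0}(1-q^m a)$, let $$K(\pmb x,\pmb y;q,t)=\prod_{i,j}\frac{(t\,\pmb x_i\pmb y_j;q)_\infty}{(\pmb x_i\pmb y_j;q)_\infty}\;\prod_{k=1}^{n-1}\prod_{i,j}\frac{1}{1-q^{-(n-k)}\pmb x^{(k)}_i\pmb y^{(k)}_j},$$ a formal power series in the variables $x^{(k)}_i,y^{(k)}_i$ over $\mathbb Q(t)((q))\supset\mathbb Q(q,t)$, all infinite products and sums being taken for coefficientwise $q$-adic convergence. Then: 1. All these infinite products converge, and $$K(\pmb x,\pmb y;q,t)=\sum_{\pmb\lambda}\frac{1}{z_{\pmb\lambda}(q,t)}\,p_{\pmb\lambda}(x^{(1)},\dots,x^{(n)})\,p_{\pmb\lambda}(y^{(1)},\dots,y^{(n)}).$$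 2. $K$ is a reproducing kernel for $\langle\!\langle\cdot,\cdot\rangle\!\rangle$: $\langle\!\langle K(\pmb x,\pmb y;q,t),f(x^{(1)},\dots,x^{(n)})\rangle\!\rangle=f(y^{(1)},\dots,y^{(n)})$ for every multi-symmetric function $f$, where the form is taken in the $x$-variables. That is, for each monomial in the $y$-variables, its coefficient in $K$ is a multi-symmetric function in $x$ over $\mathbb Q(q,t)$, and pairing it with $f(x^{(1)},\dots,x^{(n)})$ gives the coefficient of that monomial in $f(y^{(1)},\dots,y^{(n)})$. 3. Let $\{P_{\pmb\lambda}\}$ be the multi-Macdonald polynomials, i.e. the basis of the space of multi-symmetric functions characterized by $\langle\!\langle P_{\pmb\lambda},P_{\pmb\mu}\rangle\!\rangle=0$ for $\pmb\lambda\ne\pmb\mu$ and $P_{\pmb\lambda}=m_{\pmb\lambda}+\sum_{\pmb\mu<\pmb\lambda}c_{\pmb\lambda\pmb\mu}m_{\pmb\mu}$ with $c_{\pmb\lambda\pmb\mu}\in\mathbb Q(q,t)$, where $\pmb\mu\le\pmb\lambda$ means $\sum_{i<k}|\mu^{(i)}|+\mu^{(k)}_1+\dots+\mu^{(k)}_j\le\sum_{i<k}|\lambda^{(i)}|+\lambda^{(k)}_1+\dots+\lambda^{(k)}_j$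 for all $j$ and $k$. Then $\|P_{\pmb\lambda}\|^2:=\langle\!\langle P_{\pmb\lambda},P_{\pmb\lambda}\rangle\!\rangle\neq0$ for all $\pmb\lambda$, and $$K(\pmb x,\pmb y;q,t)=\sum_{\pmb\lambda}\frac{1}{\|P_{\pmb\lambda}\|^2}\,P_{\pmb\lambda}(x^{(1)},\dots,x^{(n)})\,P_{\pmb\lambda}(y^{(1)},\dots,y^{(n)}).$$ -/

import Mathlib

open scoped MvPowerSeries.WithPiTopology

namespace MultiMacdonald

noncomputable section

/-! ### Coefficients -/

/-- The field `ℚ(q,t)`, realised as `ℚ(t)(q)`. -/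
abbrev QT : Type := RatFunc (RatFunc ℚ)

/-- The parameter `q`. -/
def q : QT := RatFunc.X

/-- The parameter `t`. -/
def t : QT := RatFunc.C RatFunc.X

/-- The field `ℚ(t)((q))` of formal Laurent series in `q`, with its `q`-adic topology. It contains
`ℚ(q,t)`: rational functions are expanded in powers of `q`. Infinite products such as
`(a;q)_∞ = ∏_{m ≥ 0} (1 - q^m a)` converge over this field. -/
abbrev QTSeries : Type := LaurentSeries (RatFunc ℚ)

/-- The inclusion `ℚ(q,t) → ℚ(t)((q))`. -/
instance instAlgebraQTSeries : Algebra QT QTSeries := RatFunc.liftAlgebra _ _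

/-! ### Partitions and multi-partitions -/

/-- A partition: a finite multiset of positive integers (its non-zero parts). -/
abbrev Ptn : Type := Multiset ℕ+

/-- The degree `|λ|`. -/
def Ptn.size (l : Ptn) : ℕ := (l.map fun r : ℕ+ => (r : ℕ)).sum

/-- `λ_1 + ⋯ + λ_j`, the sum of the `j` largest parts. -/
def Ptn.partialSum (l : Ptn) (j : ℕ) : ℕ :=
  (((l.map fun r : ℕ+ => (r : ℕ)).sort (· ≥ ·)).take j).sum

/-- `z_λ = ∏_i i^{m_i(λ)} m_i(λ)!`. -/
def Ptn.z (l : Ptn) : ℕ :=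
  ∏ i ∈ l.toFinset, (i : ℕ) ^ l.count i * (l.count i).factorial

/-- An `n`-tuple of partitions; the `k`-th component of the paper is at index `k - 1`. -/
abbrev MultiPtn (n : ℕ) : Type := Fin n → Ptn

variable {n : ℕ}

/-- The dominance order `μ ≤ λ` on multi-partitions. -/
def DomLE (mu la : MultiPtn n) : Prop :=
  ∀ (k : Fin n) (j : ℕ),
    (∑ i : Fin n with i < k, (mu i).size) + (mu k).partialSum j ≤
      (∑ i : Fin n with i < k, (la i).size) + (la k).partialSum j

/-- `z_λ(q,t) = q^{(n-1)|λ| - n(λ)} z_{λ^(1)} ⋯ z_{λ^(n)} ∏_i (1 - q^{λ^(n)_i}) / (1 - t^{λ^(n)_i})`,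
where `n(λ) = ∑_k (k-1) |λ^(k)|` and `i` runs over the parts of the last component. -/
def zNorm (la : MultiPtn n) : QT :=
  q ^ (((n : ℤ) - 1) * (∑ k : Fin n, ((la k).size : ℤ)) -
      ∑ k : Fin n, (k : ℤ) * ((la k).size : ℤ)) *
    (∏ k : Fin n, ((la k).z : QT)) *
    ∏ k ∈ Finset.univ.filter (fun k : Fin n => (k : ℕ) + 1 = n),
      ((la k).map fun r : ℕ+ => (1 - q ^ (r : ℕ)) / (1 - t ^ (r : ℕ))).prod

/-! ### Symmetric functions of alphabets, as formal power series -/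

section Series

variable {σ : Type*} (R : Type*) [CommRing R]

open Classical in
/-- The power sum `p_r = ∑_{v ∈ S} X_v ^ r` of the (possibly infinite) set `S` of variables. -/
def powerSum (S : Set σ) (r : ℕ+) : MvPowerSeries σ R :=
  fun e => if ∃ v ∈ S, e = Finsupp.single v (r : ℕ) then 1 else 0

open Classical in
/-- The monomial symmetric function `m_λ` of the set `S` of variables: the sum of all monomials in
these variables whose non-zero exponents, with multiplicities, are the parts of `λ`. -/
def monomialSym (S : Set σ) (l : Ptn) : MvPowerSeries σ R :=
  fun e => if (↑e.support : Set σ) ⊆ S ∧ e.support.val.map e = l.map (fun r : ℕ+ => (r : ℕ))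
    then 1 else 0

/-- The multi-monomial symmetric function
`m_λ = m_{λ^(1)}(x^(1)) ⋯ m_{λ^(n)}(x^(n))` of the alphabets `A 0, …, A (n-1)`. -/
def mMulti (A : Fin n → Set σ) (la : MultiPtn n) : MvPowerSeries σ R :=
  ∏ k : Fin n, monomialSym R (A k) (la k)

/-- The multi-power sum
`p_λ = p_{λ^(1)}(x^(1)) p_{λ^(2)}(x^(1),x^(2)) ⋯ p_{λ^(n)}(x^(1),…,x^(n))`
of the alphabets `A 0, …, A (n-1)`. -/
def pMulti (A : Fin n → Set σ) (la : MultiPtn n) : MvPowerSeries σ R :=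
  ∏ k : Fin n, ((la k).map (powerSum R (⋃ j ≤ k, A j))).prod

end Series

/-- The space of multi-symmetric functions over `ℚ(q,t)`, i.e. the polynomial ring in the power sums
`p_r(x^(1),…,x^(k))`, `r ≥ 1`, `1 ≤ k ≤ n`, as a vector space: `f = ∑_λ f_λ p_λ` is given by its
coordinates in the basis of multi-power sums. (In infinite alphabets the `p_λ` are linearly
independent and have the same span as the `m_λ`.) -/
abbrev MultiSym (n : ℕ) : Type := MultiPtn n →₀ QT

/-- The value `f(x^(1),…,x^(n)) = ∑_λ f_λ p_λ(x^(1),…,x^(n))` of a multi-symmetric function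
on alphabets, as a formal power series over an extension of `ℚ(q,t)`. -/
def MultiSym.eval {σ : Type*} (R : Type*) [CommRing R] [Algebra QT R] (A : Fin n → Set σ)
    (f : MultiSym n) : MvPowerSeries σ R :=
  f.sum fun la c => c • pMulti R A la

/-- The scalar product `⟨⟨f, g⟩⟩_{q,t,n}`: the bilinear form
with `⟨⟨p_λ, p_μ⟩⟩ = δ_{λμ} z_λ(q,t)`. -/
def scalar (f g : MultiSym n) : QT := f.sum fun la c => c * g la * zNorm la

/-- `⟨⟨p_λ, p_μ⟩⟩ = δ_{λμ} z_λ(q,t)`. -/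
theorem scalar_single (la mu : MultiPtn n) [Decidable (la = mu)] :
    scalar (Finsupp.single la 1) (Finsupp.single mu 1) = if la = mu then zNorm la else 0 := by
  classical
  rw [scalar, Finsupp.sum_single_index (by simp), Finsupp.single_apply]
  by_cases h : la = mu
  · subst h; simp
  · simp [h, Ne.symm h]

/-- The `n` disjoint infinite alphabets `x^(k) = {x^(k)_i : i ∈ ℕ}`. -/
def stdAlphabet (n : ℕ) (k : Fin n) : Set (Fin n × ℕ) := {v | v.1 = k}

/-- `P_λ` is the family of multi-Macdonald polynomials: a basis of the space of multi-symmetric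
functions which is unitriangular in the multi-monomials for the dominance order,
`P_λ = m_λ + ∑_{μ < λ} c_μ m_μ` with `c_μ ∈ ℚ(q,t)`,
and orthogonal for `⟨⟨·,·⟩⟩_{q,t,n}`. -/
structure IsMultiMacdonald (P : Module.Basis (MultiPtn n) QT (MultiSym n)) : Prop where
  triangular : ∀ la : MultiPtn n, ∃ c : MultiPtn n →₀ QT,
    (∀ mu ∈ c.support, DomLE mu la ∧ mu ≠ la) ∧
    (P la).eval QT (stdAlphabet n) =
      mMulti QT (stdAlphabet n) la + c.sum fun mu a => a • mMulti QT (stdAlphabet n) mu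
  orthogonal : ∀ la mu : MultiPtn n, la ≠ mu → scalar (P la) (P mu) = 0

/-! ### The kernel -/

/-- Two families of `n` infinite alphabets: the variables `x^(k)_i` and `y^(k)_i`. -/
abbrev XY (n : ℕ) : Type := (Fin n × ℕ) ⊕ (Fin n × ℕ)

/-- Formal power series in the variables `x^(k)_i`, `y^(k)_i` over `ℚ(t)((q))`, with the topology of
coefficientwise `q`-adic convergence. -/
abbrev SeriesXY (n : ℕ) : Type := MvPowerSeries (XY n) QTSeries

/-- The alphabet `x^(k)`. -/
def xAlphabet (n : ℕ) (k : Fin n) : Set (XY n) := Sum.inl '' stdAlphabet n k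

/-- The alphabet `y^(k)`. -/
def yAlphabet (n : ℕ) (k : Fin n) : Set (XY n) := Sum.inr '' stdAlphabet n k

/-- The variable `x^(k)_i`, for `a = (k, i)`. -/
def xVar (a : Fin n × ℕ) : SeriesXY n := MvPowerSeries.X (Sum.inl a)

/-- The variable `y^(k)_i`, for `a = (k, i)`. -/
def yVar (a : Fin n × ℕ) : SeriesXY n := MvPowerSeries.X (Sum.inr a)

/-- The (indices of the) variables of the union of the first `k` alphabets. -/
abbrev UpTo (k : Fin n) : Type := {a : Fin n × ℕ // a.1 ≤ k}

/-- The factors `1 - q^m a` of `(a;q)_∞`. -/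
def qPochFactor (a : SeriesXY n) (m : ℕ) : SeriesXY n := 1 - (q ^ m) • a

/-- `(a;q)_∞ = ∏_{m ≥ 0} (1 - q^m a)`. -/
def qPoch (a : SeriesXY n) : SeriesXY n := ∏' m : ℕ, qPochFactor a m

/-- The factor `(t x_i y_j;q)_∞ / (x_i y_j;q)_∞`. -/
def macFactor (ab : (Fin n × ℕ) × (Fin n × ℕ)) : SeriesXY n :=
  qPoch (t • (xVar ab.1 * yVar ab.2)) * (qPoch (xVar ab.1 * yVar ab.2))⁻¹

/-- The factor `1 / (1 - q^{-(n-k)} x_i y_j)`, with `x_i`, `y_j` in the unions of the first `k`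
alphabets (the index `k : Fin n` starts from `0`). -/
def cauchyFactor (k : Fin n) (ab : UpTo k × UpTo k) : SeriesXY n :=
  (1 - (q ^ (-((n : ℤ) - ((k : ℤ) + 1)))) • (xVar ab.1.1 * yVar ab.2.1))⁻¹

/-- The kernel `K(x,y;q,t)`; the product over `k` is over the alphabets other than the last. -/
def kernel (n : ℕ) : SeriesXY n :=
  (∏' ab : (Fin n × ℕ) × (Fin n × ℕ), macFactor ab) *
    ∏ k ∈ Finset.univ.filter (fun k : Fin n => (k : ℕ) + 1 < n), ∏' ab : UpTo k × UpTo k, cauchyFactor k ab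

/-- All the infinite products in the definition of the kernel converge. -/
def KernelConverges (n : ℕ) : Prop :=
  (∀ a b : Fin n × ℕ, Multipliable (qPochFactor (t • (xVar a * yVar b))) ∧
    Multipliable (qPochFactor (xVar a * yVar b))) ∧
  Multipliable (macFactor (n := n)) ∧
  ∀ k : Fin n, (k : ℕ) + 1 < n → Multipliable (cauchyFactor k)

/-- `κ(x,y)` is a reproducing kernel for the scalar product: `⟨⟨κ(x,y), f(x)⟩⟩ = f(y)` for all `f`,
the scalar product being taken in the variables `x` only. That is, for each monomial `y^b`, the
coefficient of `y^b` in `κ` is (the value on the alphabets `x^(k)` of) a multi-symmetric function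
`g`, and `⟨⟨g, f⟩⟩` is the coefficient of `y^b` in `f(y)`. -/
def IsReproducingKernel (κ : SeriesXY n) : Prop :=
  ∀ b : Fin n × ℕ →₀ ℕ, ∃ g : MultiSym n,
    (∀ a : Fin n × ℕ →₀ ℕ, MvPowerSeries.coeff (Finsupp.sumElim a b) κ =
      algebraMap QT QTSeries (MvPowerSeries.coeff a (g.eval QT (stdAlphabet n)))) ∧
    ∀ f : MultiSym n, scalar g f = MvPowerSeries.coeff b (f.eval QT (stdAlphabet n))

end

end MultiMacdonald

open MultiMacdonald

namespace MultiMacdonald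

noncomputable section

variable {n : ℕ}

/-! ### Logarithmic derivatives of power series -/

section LogDeriv

open MvPowerSeries Finset Filter Topology

variable {σ : Type*} {R : Type*} [Field R]

/-! Let E be the derivation scaling each monomial by half its degree, so that E fixes every `x_i
y_j`. In characteristic zero a series with constant coefficient 1 is determined by its logarithmic
derivative: E f = L f is a recursion on coefficients by degree (`HasLogDeriv.eq`). Both sides of the
power-sum expansion have logarithmic derivative L = ∑_k ∑_r c_{k,r} p_r(x^(1),…,x^(k))
p_r(y^(1),…,y^(k)), where c is `kerCoef`; E cancels the 1/r of log K.

For the kernel, a factor 1 - a x y contributes -∑_r (a x y)^r; geometric series in q^r give the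
coefficients for the q-Pochhammer quotients, and sums over variables give power sums
(`hasLogDeriv_kernel`). The solution of E f = L f depends continuously on L, so a convergent sum of
logarithmic derivatives gives a convergent product (`hasLogDeriv_tprod`). This yields all
convergence claims, q-adic ones included.

For the sum over λ, E multiplies the λ-term by |λ| = ∑_{k,r} r m_r(λ^(k)), and removing one part r
matches the resulting terms with those of L times the sum (`euler_tsum_expTerm`). The input is the
recursion for z_λ(q,t) in `zNorm_add_single`.

By homogeneity the coefficient of y^b in K is a finite combination of the p_λ(x). Pairing it with f
cancels z_λ and leaves the y^b-coefficient of f (`scalar_kernelCoeff`). Expanding it in an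
orthogonal basis then gives the Macdonald expansion. -/

/-- Half the Euler derivation: the monomial `X^e` is an eigenvector with eigenvalue `|e| / 2`. -/
def euler (f : MvPowerSeries σ R) : MvPowerSeries σ R := fun e => (e.degree : R) / 2 * coeff e f

theorem coeff_euler (e : σ →₀ ℕ) (f : MvPowerSeries σ R) :
    coeff e (euler f) = (e.degree : R) / 2 * coeff e f := rfl

theorem euler_mul (f g : MvPowerSeries σ R) : euler (f * g) = euler f * g + f * euler g := by
  classical
  ext e
  simp only [coeff_euler, map_add, coeff_mul]
  rw [mul_sum, ← sum_add_distrib]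
  refine sum_congr rfl fun p hp => ?_
  rw [← mem_antidiagonal.1 hp, map_add]
  push_cast
  ring

theorem euler_one : euler (1 : MvPowerSeries σ R) = 0 := by
  classical
  ext e
  rw [coeff_euler, coeff_one]
  split_ifs with h <;> simp [h]

theorem euler_sub (f g : MvPowerSeries σ R) : euler (f - g) = euler f - euler g := by
  ext e
  simp [coeff_euler, mul_sub]

/-- `f` has constant coefficient `1` and logarithmic derivative `L`. -/
def HasLogDeriv (L f : MvPowerSeries σ R) : Prop := euler f = L * f ∧ constantCoeff f = 1

theorem hasLogDeriv_one : HasLogDeriv (0 : MvPowerSeries σ R) 1 :=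
  ⟨by rw [euler_one, zero_mul], map_one _⟩

theorem HasLogDeriv.mul {L M f g : MvPowerSeries σ R} (hf : HasLogDeriv L f)
    (hg : HasLogDeriv M g) : HasLogDeriv (L + M) (f * g) :=
  ⟨by rw [euler_mul, hf.1, hg.1]; ring, by rw [map_mul, hf.2, hg.2, one_mul]⟩

theorem HasLogDeriv.prod {ι : Type*} {L f : ι → MvPowerSeries σ R} (s : Finset ι)
    (h : ∀ i ∈ s, HasLogDeriv (L i) (f i)) : HasLogDeriv (∑ i ∈ s, L i) (∏ i ∈ s, f i) := by
  classical
  induction s using Finset.induction_on with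
  | empty => simpa using hasLogDeriv_one
  | insert i s hi ih =>
    rw [sum_insert hi, prod_insert hi]
    exact (h i (mem_insert_self i s)).mul (ih fun j hj => h j (mem_insert_of_mem hj))

theorem HasLogDeriv.inv {L f : MvPowerSeries σ R} (h : HasLogDeriv L f) :
    HasLogDeriv (-L) f⁻¹ := by
  have h0 : f * f⁻¹ = 1 := MvPowerSeries.mul_inv_cancel f (by rw [h.2]; exact one_ne_zero)
  refine ⟨?_, by rw [constantCoeff_inv, h.2, inv_one]⟩
  have h1 := euler_mul f f⁻¹
  rw [h0, euler_one, h.1] at h1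
  linear_combination (-f⁻¹) * h1 - (euler f⁻¹ + L * f⁻¹) * h0

theorem HasLogDeriv.constantCoeff_eq_zero {L f : MvPowerSeries σ R} (h : HasLogDeriv L f) :
    constantCoeff L = 0 := by
  have h1 := congrArg constantCoeff h.1
  rw [map_mul, h.2, mul_one, ← coeff_zero_eq_constantCoeff_apply, coeff_euler] at h1
  simpa using h1.symm

/-- `L` has no constant term, so the product `L * f` involves only coefficients of `f` of degree
below that of `e`: a recursion for `f`. -/
theorem HasLogDeriv.coeff_eq [CharZero R] [DecidableEq σ] {L f : MvPowerSeries σ R}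
    (h : HasLogDeriv L f)
    {e : σ →₀ ℕ} (he : e ≠ 0) : coeff e f = ((e.degree : R) / 2)⁻¹ *
      ∑ p ∈ (antidiagonal e).filter (fun p => p.2.degree < e.degree), coeff p.1 L * coeff p.2 f := by
  classical
  have hd : (e.degree : R) ≠ 0 := by
    rw [Nat.cast_ne_zero]
    exact fun h => he ((Finsupp.degree_eq_zero_iff e).1 h)
  have h1 := congrArg (coeff e) h.1
  rw [coeff_euler, coeff_mul] at h1
  rw [eq_inv_mul_iff_mul_eq₀ (div_ne_zero hd two_ne_zero), h1]
  symm
  refine sum_subset (filter_subset _ _) fun p hp hp' => ?_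
  have h2 : p.1.degree + p.2.degree = e.degree := by rw [← map_add, mem_antidiagonal.1 hp]
  have h3 : p.1 = 0 := by
    rw [← Finsupp.degree_eq_zero_iff]
    simp only [mem_filter, hp, true_and] at hp'
    omega
  rw [h3, coeff_zero_eq_constantCoeff_apply, h.constantCoeff_eq_zero, zero_mul]

theorem HasLogDeriv.eq [CharZero R] {L f g : MvPowerSeries σ R} (hf : HasLogDeriv L f)
    (hg : HasLogDeriv L g) : f = g := by
  classical
  ext e
  induction h : e.degree using Nat.strong_induction_on generalizing e with
  | _ d ih =>
    subst h
    by_cases he : e = 0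
    · rw [he, coeff_zero_eq_constantCoeff_apply, coeff_zero_eq_constantCoeff_apply, hf.2, hg.2]
    · rw [hf.coeff_eq he, hg.coeff_eq he]
      congr 1
      refine sum_congr rfl fun p hp => ?_
      rw [ih _ (mem_filter.1 hp).2 _ rfl]

open Classical in
/-- The coefficients of the power series with logarithmic derivative `L`. -/
def expCoeff (L : MvPowerSeries σ R) (e : σ →₀ ℕ) : R :=
  if e = 0 then 1 else ((e.degree : R) / 2)⁻¹ *
    ∑ p ∈ (antidiagonal e).attach,
      if _h : p.1.2.degree < e.degree then coeff p.1.1 L * expCoeff L p.1.2 else 0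
termination_by e.degree

/-- The power series with logarithmic derivative `L`. -/
def expSeries (L : MvPowerSeries σ R) : MvPowerSeries σ R := expCoeff L

theorem coeff_expSeries_zero (L : MvPowerSeries σ R) : coeff 0 (expSeries L) = 1 := by
  change expCoeff L 0 = 1
  rw [expCoeff, if_pos rfl]

theorem coeff_expSeries [DecidableEq σ] (L : MvPowerSeries σ R) {e : σ →₀ ℕ} (he : e ≠ 0) :
    coeff e (expSeries L) = ((e.degree : R) / 2)⁻¹ *
      ∑ p ∈ (antidiagonal e).filter (fun p => p.2.degree < e.degree),
        coeff p.1 L * coeff p.2 (expSeries L) := by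
  change expCoeff L e = _
  rw [expCoeff, if_neg he, sum_filter]
  congr 1
  simp only [dite_eq_ite]
  convert sum_attach (antidiagonal e) fun p : (σ →₀ ℕ) × (σ →₀ ℕ) =>
    if p.2.degree < e.degree then coeff p.1 L * expCoeff L p.2 else 0
  rfl

theorem hasLogDeriv_expSeries [CharZero R] {L : MvPowerSeries σ R} (hL : constantCoeff L = 0) :
    HasLogDeriv L (expSeries L) := by
  classical
  refine ⟨?_, coeff_expSeries_zero L⟩
  ext e
  rw [coeff_euler]
  by_cases he : e = 0
  · simp [he, hL]
  · have hd : (e.degree : R) ≠ 0 := by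
      rw [Nat.cast_ne_zero]
      exact fun h => he ((Finsupp.degree_eq_zero_iff e).1 h)
    rw [coeff_expSeries L he, mul_inv_cancel_left₀ (div_ne_zero hd two_ne_zero), coeff_mul]
    refine sum_subset (filter_subset _ _) fun p hp hp' => ?_
    have h2 : p.1.degree + p.2.degree = e.degree := by rw [← map_add, mem_antidiagonal.1 hp]
    have h3 : p.1 = 0 := by
      rw [← Finsupp.degree_eq_zero_iff]
      simp only [mem_filter, hp, true_and] at hp'
      omega
    rw [h3, coeff_zero_eq_constantCoeff_apply, hL, zero_mul]

variable [TopologicalSpace R] [IsTopologicalRing R]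

/-- By the recursion, each coefficient is a polynomial in finitely many coefficients of `L`. -/
theorem continuous_expSeries : Continuous (expSeries : MvPowerSeries σ R → MvPowerSeries σ R) := by
  classical
  refine continuous_pi fun e => ?_
  induction h : e.degree using Nat.strong_induction_on generalizing e with
  | _ d ih =>
    subst h
    change Continuous fun L : MvPowerSeries σ R => coeff e (expSeries L)
    by_cases he : e = 0
    · subst he
      simp only [coeff_expSeries_zero]
      exact continuous_const
    · simp only [coeff_expSeries _ he]
      refine continuous_const.mul (continuous_finsetSum _ fun p hp => ?_)
      exact (WithPiTopology.continuous_coeff R p.1).mul (ih _ (mem_filter.1 hp).2 _ rfl)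

/-- By uniqueness each finite product is `expSeries` of the finite sum of the `L i`; continuity then
carries the limit across. -/
theorem hasProd_of_hasSum_logDeriv [CharZero R] {ι : Type*} {L f : ι → MvPowerSeries σ R}
    {M : MvPowerSeries σ R} (h : ∀ i, HasLogDeriv (L i) (f i)) (hL : HasSum L M) :
    HasProd f (expSeries M) := by
  have h1 : ∀ s : Finset ι, ∏ i ∈ s, f i = expSeries (∑ i ∈ s, L i) := fun s =>
    have h2 := HasLogDeriv.prod s fun i _ => h i
    h2.eq (hasLogDeriv_expSeries h2.constantCoeff_eq_zero)
  unfold HasProd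
  simp only [h1]
  exact (continuous_expSeries.tendsto M).comp hL

variable [T2Space R]

theorem hasLogDeriv_tprod [CharZero R] {ι : Type*} {L f : ι → MvPowerSeries σ R}
    {M : MvPowerSeries σ R} (h : ∀ i, HasLogDeriv (L i) (f i)) (hL : HasSum L M) :
    Multipliable f ∧ HasLogDeriv M (∏' i, f i) := by
  have h1 := hasProd_of_hasSum_logDeriv h hL
  refine ⟨h1.multipliable, ?_⟩
  rw [h1.tprod_eq]
  refine hasLogDeriv_expSeries ?_
  have h2 := hL.map (constantCoeff (σ := σ) (R := R)) (WithPiTopology.continuous_constantCoeff R)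
  refine h2.unique ?_
  convert hasSum_zero using 1
  exact funext fun i => (h i).constantCoeff_eq_zero

end LogDeriv

/-! ### Summation of power series -/

section Summation

open MvPowerSeries Filter Topology

variable {σ : Type*} {R : Type*} [Field R]

open Classical in
/-- The series `∑_{r ≥ 1} c_r X^{r u}`. -/
def diag (u : σ →₀ ℕ) (c : ℕ+ → R) : MvPowerSeries σ R := fun e =>
  if h : ∃ r : ℕ+, e = (r : ℕ) • u then c h.choose else 0

/-- The index `r` is chosen before `c`, so identities and limits of coefficient sequences pass to
`diag` termwise, even for `u = 0`, where `r` is not unique. -/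
theorem coeff_diag_cases (u e : σ →₀ ℕ) :
    (∃ r : ℕ+, ∀ c : ℕ+ → R, coeff e (diag u c) = c r) ∨
      ∀ c : ℕ+ → R, coeff e (diag u c) = 0 := by
  by_cases h : ∃ r : ℕ+, e = (r : ℕ) • u
  · exact Or.inl ⟨h.choose, fun c => dif_pos h⟩
  · exact Or.inr fun c => dif_neg h

theorem diag_add (u : σ →₀ ℕ) (c d : ℕ+ → R) : diag u c + diag u d = diag u (c + d) := by
  ext e
  rcases coeff_diag_cases (R := R) u e with ⟨r, h⟩ | h <;> simp [h]

theorem diag_neg (u : σ →₀ ℕ) (c : ℕ+ → R) : -diag u c = diag u (-c) := by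
  ext e
  rcases coeff_diag_cases (R := R) u e with ⟨r, h⟩ | h <;> simp [h]

theorem smul_left_injective_of_ne_zero {u : σ →₀ ℕ} (hu : u ≠ 0) {r s : ℕ} (h : r • u = s • u) :
    r = s := by
  obtain ⟨v, hv⟩ := Finsupp.ne_iff.1 hu
  have := DFunLike.congr_fun h v
  simp only [Finsupp.smul_apply, smul_eq_mul] at this
  exact Nat.eq_of_mul_eq_mul_right (Nat.pos_of_ne_zero hv) this

variable [TopologicalSpace R]

theorem summable_of_finite_coeff {ι : Type*} {f : ι → MvPowerSeries σ R}
    (h : ∀ e, {i | coeff e (f i) ≠ 0}.Finite) : Summable f :=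
  WithPiTopology.summable_iff_summable_coeff.2 fun e =>
    summable_of_hasFiniteSupport (h e)

theorem hasSum_euler [IsTopologicalRing R] {ι : Type*} {f : ι → MvPowerSeries σ R}
    {a : MvPowerSeries σ R} (h : HasSum f a) : HasSum (fun i => euler (f i)) (euler a) :=
  WithPiTopology.hasSum_iff_hasSum_coeff.2 fun e =>
    (WithPiTopology.hasSum_iff_hasSum_coeff.1 h e).mul_left ((e.degree : R) / 2)

theorem hasSum_monomial_diag {u : σ →₀ ℕ} (hu : u ≠ 0) (c : ℕ+ → R) :
    HasSum (fun r : ℕ+ => monomial ((r : ℕ) • u) (c r)) (diag u c) := by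
  classical
  refine WithPiTopology.hasSum_iff_hasSum_coeff.2 fun e => ?_
  by_cases h : ∃ r : ℕ+, e = (r : ℕ) • u
  · have h1 : coeff e (diag u c) = coeff e (monomial ((h.choose : ℕ) • u) (c h.choose)) := by
      conv_rhs => rw [coeff_monomial, if_pos h.choose_spec]
      exact dif_pos h
    rw [h1]
    refine hasSum_single h.choose fun r hr => ?_
    rw [coeff_monomial, if_neg]
    intro he
    exact hr (PNat.coe_injective (smul_left_injective_of_ne_zero hu (he.symm.trans h.choose_spec)))
  · have h1 : coeff e (diag u c) = 0 := dif_neg h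
    rw [h1]
    convert hasSum_zero using 1
    funext r
    rw [coeff_monomial, if_neg fun he => h ⟨r, he⟩]

theorem hasSum_diag {ι : Type*} (u : σ →₀ ℕ) {c : ι → ℕ+ → R} {d : ℕ+ → R}
    (h : ∀ r, HasSum (fun i => c i r) (d r)) : HasSum (fun i => diag u (c i)) (diag u d) := by
  refine WithPiTopology.hasSum_iff_hasSum_coeff.2 fun e => ?_
  rcases coeff_diag_cases (R := R) u e with ⟨r, h1⟩ | h1
  · simp only [h1]
    exact h r
  · simp only [h1]
    exact hasSum_zero

/-- Degree 2 makes `monomial u a` a fixed point of `euler`; dividing by `1 - monomial u a` gives a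
geometric series without its constant term. -/
theorem hasLogDeriv_one_sub_monomial [IsTopologicalRing R] [T2Space R] [CharZero R]
    {u : σ →₀ ℕ} (hu : u.degree = 2) (a : R) :
    HasLogDeriv (-diag u fun r => a ^ (r : ℕ)) (1 - monomial u a) := by
  classical
  have hu0 : u ≠ 0 := by rintro rfl; simp at hu
  have h0 : constantCoeff (monomial u a) = 0 := by
    rw [← coeff_zero_eq_constantCoeff_apply, coeff_monomial, if_neg hu0.symm]
  have h1 := (WithPiTopology.summable_pow_of_constantCoeff_eq_zero h0).hasSum
  have h2 := WithPiTopology.tsum_pow_mul_one_sub_of_constantCoeff_eq_zero h0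
  have h3 := h1.mul_left (monomial u a)
  -- The bijection sends `r` to `r - 1`; the factor `monomial u a` in front restores the exponent
  -- `r`.
  rw [← Equiv.pnatEquivNat.hasSum_iff] at h3
  have h4 : diag u (fun r => a ^ (r : ℕ)) = monomial u a * ∑' i : ℕ, monomial u a ^ i := by
    refine (hasSum_monomial_diag hu0 _).unique ?_
    have h5 : (fun r : ℕ+ => monomial ((r : ℕ) • u) (a ^ (r : ℕ))) =
        (fun i => monomial u a * monomial u a ^ i) ∘ Equiv.pnatEquivNat := by
      funext r
      simp only [Function.comp_apply, ← pow_succ']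
      rw [← monomial_pow]
      congr 1
      exact (PNat.natPred_add_one r).symm
    rw [h5]
    exact h3
  refine ⟨?_, by rw [map_sub, h0, map_one, sub_zero]⟩
  have h5 : euler (monomial u a) = monomial u a := by
    ext e
    rw [coeff_euler, coeff_monomial]
    split_ifs with he
    · rw [he, hu]; simp
    · simp
  rw [euler_sub, euler_one, h5, h4]
  linear_combination monomial u a * h2

end Summation

/-! ### Cauchy sums of power sums -/

section CauchySum

open MvPowerSeries Filter Topology

variable {σ : Type*} {R : Type*} [Field R]

/-- The exponent of `X_a Y_b`. -/
def pairExp (ab : σ × σ) : σ ⊕ σ →₀ ℕ :=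
  Finsupp.single (Sum.inl ab.1) 1 + Finsupp.single (Sum.inr ab.2) 1

theorem degree_pairExp (ab : σ × σ) : (pairExp ab).degree = 2 := by
  simp [pairExp]

theorem pairExp_ne_zero (ab : σ × σ) : pairExp ab ≠ 0 := by
  intro h
  have := degree_pairExp ab
  rw [h] at this
  simp at this

theorem smul_pairExp_injective :
    Function.Injective fun x : (σ × σ) × ℕ+ => (x.2 : ℕ) • pairExp x.1 := by
  classical
  rintro ⟨⟨a, b⟩, r⟩ ⟨⟨a', b'⟩, s⟩ h
  have hr := r.pos
  have hs := s.pos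
  have h1 := DFunLike.congr_fun h (Sum.inl a)
  have h2 := DFunLike.congr_fun h (Sum.inr b)
  simp only [pairExp, Finsupp.smul_apply, Finsupp.add_apply, Finsupp.single_apply, smul_eq_mul,
    Sum.inl.injEq, Sum.inr.injEq, reduceCtorEq, if_false, if_true, add_zero, zero_add,
    mul_one] at h1 h2
  split_ifs at h1 h2 with h3 h4
  · subst h3 h4
    rw [PNat.coe_injective (h1.trans (mul_one _))]
  all_goals omega

theorem monomial_pairExp (ab : σ × σ) (c : R) (r : ℕ) :
    monomial (r • pairExp ab) c = c • ((X (Sum.inl ab.1) : MvPowerSeries (σ ⊕ σ) R) ^ r *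
      (X (Sum.inr ab.2) : MvPowerSeries (σ ⊕ σ) R) ^ r) := by
  rw [X_pow_eq, X_pow_eq, monomial_mul_monomial, ← map_smul, smul_eq_mul, mul_one, mul_one]
  simp [pairExp]

variable [TopologicalSpace R]

theorem hasSum_powerSum {ι : Type*} {v : ι → σ} (hv : Function.Injective v) {S : Set σ}
    (hS : S = Set.range v) (r : ℕ+) :
    HasSum (fun i => (X (v i) : MvPowerSeries σ R) ^ (r : ℕ)) (powerSum R S r) := by
  classical
  subst hS
  refine WithPiTopology.hasSum_iff_hasSum_coeff.2 fun e => ?_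
  simp only [coeff_X_pow]
  by_cases h : ∃ i, e = Finsupp.single (v i) (r : ℕ)
  · obtain ⟨i, rfl⟩ := h
    have h1 : coeff (Finsupp.single (v i) (r : ℕ)) (powerSum R (Set.range v) r) = 1 :=
      if_pos ⟨v i, ⟨i, rfl⟩, rfl⟩
    rw [h1]
    convert hasSum_ite_eq i (1 : R) using 2 with j
    refine if_congr ?_ rfl rfl
    rw [Finsupp.single_left_inj r.ne_zero, hv.eq_iff, eq_comm]
  · have h1 : coeff e (powerSum R (Set.range v) r) = 0 := by
      refine if_neg ?_
      rintro ⟨_, ⟨i, rfl⟩, hi⟩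
      exact h ⟨i, hi⟩
    rw [h1]
    have h2 : (fun i => if e = Finsupp.single (v i) (r : ℕ) then (1 : R) else 0) = fun _ => 0 :=
      funext fun i => if_neg fun hi => h ⟨i, hi⟩
    rw [h2]
    exact hasSum_zero

/-- The series `∑_r c_r p_r(x) p_r(y)`, where the variables `x`, `y` are indexed by `v`. -/
def cauchySum {ι : Type*} (v : ι → σ) (c : ℕ+ → R) : MvPowerSeries (σ ⊕ σ) R :=
  ∑' i : (ι × ι) × ℕ+, monomial ((i.2 : ℕ) • pairExp (Prod.map v v i.1)) (c i.2)

/-- Distinct indices give distinct monomials, so every coefficient receives at most one nonzero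
term, whatever the size of `c`. -/
theorem summable_monomial_pairExp {ι κ : Type*} {v : ι → σ} (hv : Function.Injective v)
    {g : κ → (ι × ι) × ℕ+} (hg : Function.Injective g) (c : κ → R) :
    Summable fun i => monomial (((g i).2 : ℕ) • pairExp (Prod.map v v (g i).1)) (c i) := by
  classical
  refine summable_of_finite_coeff fun e => Set.Subsingleton.finite fun i hi j hj => ?_
  rw [Set.mem_ofPred_eq, coeff_monomial, ne_eq, ite_eq_right_iff, Classical.not_imp] at hi hj
  have h1 := smul_pairExp_injective (σ := σ)
    (a₁ := (Prod.map v v (g i).1, (g i).2)) (a₂ := (Prod.map v v (g j).1, (g j).2))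
    (hi.1.symm.trans hj.1)
  refine hg (Prod.ext ((hv.prodMap hv) (congrArg Prod.fst h1)) ?_)
  exact (Prod.ext_iff.1 h1).2

variable [IsTopologicalRing R]

/-- The triple sum over two variables and `r` is sliced here by the pair of variables, matching the
factors of the product; `hasSum_powerSum_mul_powerSum` slices it by `r`. -/
theorem hasSum_diag_cauchySum {ι : Type*} {v : ι → σ} (hv : Function.Injective v) (c : ℕ+ → R) :
    HasSum (fun ab : ι × ι => diag (pairExp (Prod.map v v ab)) c) (cauchySum v c) :=
  (summable_monomial_pairExp hv Function.injective_id fun i => c i.2).hasSum.prod_fiberwise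
    fun _ => hasSum_monomial_diag (pairExp_ne_zero _) c

theorem hasSum_powerSum_mul_powerSum [T2Space R] {ι : Type*} {v : ι → σ} (hv : Function.Injective v)
    {S T : Set (σ ⊕ σ)} (hS : S = Set.range (Sum.inl ∘ v)) (hT : T = Set.range (Sum.inr ∘ v))
    (c : ℕ+ → R) :
    HasSum (fun r : ℕ+ => c r • (powerSum R S r * powerSum R T r)) (cauchySum v c) := by
  have h := (summable_monomial_pairExp hv Function.injective_id fun i => c i.2).hasSum
  rw [← (Equiv.prodComm ℕ+ (ι × ι)).hasSum_iff] at h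
  refine h.prod_fiberwise fun r => ?_
  have hx := hasSum_powerSum (R := R) (Sum.inl_injective.comp hv) hS r
  have hy := hasSum_powerSum (R := R) (Sum.inr_injective.comp hv) hT r
  have h1 := summable_monomial_pairExp (R := R) hv
    (Prod.mk_left_injective r : Function.Injective fun ab : ι × ι => (ab, r)) fun _ => 1
  simp only [monomial_pairExp, one_smul] at h1
  have h2 := hx.mul hy h1
  have h3 := WithPiTopology.hasSum_iff_hasSum_coeff.1 h2
  refine WithPiTopology.hasSum_iff_hasSum_coeff.2 fun e => ?_
  have h4 := (h3 e).mul_left (c r)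
  simpa only [Function.comp_def, Equiv.prodComm_apply, Prod.swap, monomial_pairExp, id,
    coeff_smul, Prod.map_fst, Prod.map_snd] using h4

end CauchySum

/-! ### The coefficient field -/

theorem algebraMap_q : algebraMap QT QTSeries q = HahnSeries.single 1 1 := by
  rw [q, ← RatFunc.algebraMap_X, ← IsScalarTower.algebraMap_apply]
  simp

instance : CharZero QT := algebraRat.charZero _

instance : CharZero QTSeries := charZero_of_injective_algebraMap (algebraMap QT QTSeries).injective

theorem q_ne_zero : q ≠ 0 := RatFunc.X_ne_zero

theorem one_sub_q_pow_ne_zero (r : ℕ+) : 1 - q ^ (r : ℕ) ≠ 0 := by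
  intro h
  have h1 : (Polynomial.X ^ (r : ℕ) : Polynomial (RatFunc ℚ)) = 1 := by
    apply RatFunc.algebraMap_injective (RatFunc ℚ)
    rw [map_pow, RatFunc.algebraMap_X, map_one]
    exact (sub_eq_zero.1 h).symm
  have h2 := congrArg Polynomial.natDegree h1
  rw [Polynomial.natDegree_X_pow, Polynomial.natDegree_one] at h2
  exact r.ne_zero h2

theorem one_sub_t_pow_ne_zero (r : ℕ+) : 1 - t ^ (r : ℕ) ≠ 0 := by
  intro h
  have h1 : (Polynomial.X ^ (r : ℕ) : Polynomial ℚ) = 1 := by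
    apply RatFunc.algebraMap_injective ℚ
    apply (RatFunc.C (K := RatFunc ℚ)).injective
    rw [map_pow, RatFunc.algebraMap_X, map_one, map_one, map_pow]
    exact (sub_eq_zero.1 h).symm
  have h2 := congrArg Polynomial.natDegree h1
  rw [Polynomial.natDegree_X_pow, Polynomial.natDegree_one] at h2
  exact r.ne_zero h2

/-- Valuation balls are open subgroups. This makes convergence of the terms to zero sufficient for
summability. -/
instance : NonarchimedeanAddGroup QTSeries where
  is_nonarchimedean U hU := by
    obtain ⟨γ, hγ⟩ := Valued.mem_nhds_zero.1 hU
    exact ⟨⟨Valued.v.restrict.ltAddSubgroup γ, AddSubgroup.isOpen_of_mem_nhds _ (g := 0)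
      (Valued.mem_nhds_zero.2 ⟨γ, subset_rfl⟩)⟩, hγ⟩

theorem summable_q_pow (r : ℕ+) :
    Summable fun m : ℕ => (algebraMap QT QTSeries q ^ (r : ℕ)) ^ m := by
  apply NonarchimedeanAddGroup.summable_of_tendsto_cofinite_zero
  rw [Nat.cofinite_eq_atTop]
  apply Valued.tendsto_zero_pow_of_v_lt_one
  rw [algebraMap_q, map_pow, LaurentSeries.valuation_single_zpow]
  refine pow_lt_one' ?_ r.ne_zero
  rw [← WithZero.exp_zero, WithZero.exp_lt_exp]
  simp

/-- The value comes from splitting off the first term: S = 1 + q^r S. -/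
theorem hasSum_q_pow (r : ℕ+) :
    HasSum (fun m : ℕ => (algebraMap QT QTSeries q ^ m) ^ (r : ℕ))
      (algebraMap QT QTSeries (1 - q ^ (r : ℕ))⁻¹) := by
  have h := (summable_q_pow r).hasSum
  have h1 := (summable_q_pow r).tsum_eq_zero_add
  simp only [pow_zero, pow_succ'] at h1
  rw [tsum_mul_left] at h1
  have h2 : ∑' m : ℕ, (algebraMap QT QTSeries q ^ (r : ℕ)) ^ m =
      algebraMap QT QTSeries (1 - q ^ (r : ℕ))⁻¹ := by
    rw [map_inv₀]
    apply eq_inv_of_mul_eq_one_left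
    rw [map_sub, map_one, map_pow]
    linear_combination h1
  rw [h2] at h
  simpa only [← pow_mul, mul_comm] using h

/-! ### The logarithmic derivative of the kernel -/

section Kernel

open MvPowerSeries

/-- The multiplier of `p_r(x^(1),…,x^(k)) p_r(y^(1),…,y^(k)) / r` in the logarithm of the kernel. -/
def kerCoef (k : Fin n) (r : ℕ+) : QT :=
  if (k : ℕ) + 1 = n then (1 - t ^ (r : ℕ)) / (1 - q ^ (r : ℕ))
  else (q ^ (-((n : ℤ) - ((k : ℤ) + 1)))) ^ (r : ℕ)

theorem kerCoef_ne_zero (k : Fin n) (r : ℕ+) : kerCoef k r ≠ 0 := by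
  unfold kerCoef
  split_ifs
  · exact div_ne_zero (one_sub_t_pow_ne_zero r) (one_sub_q_pow_ne_zero r)
  · exact pow_ne_zero _ (zpow_ne_zero _ q_ne_zero)

theorem smul_xVar_mul_yVar (c : QT) (ab : (Fin n × ℕ) × (Fin n × ℕ)) :
    c • (xVar ab.1 * yVar ab.2) = monomial (pairExp ab) (algebraMap QT QTSeries c) := by
  have h := monomial_pairExp ab (algebraMap QT QTSeries c) 1
  rw [one_smul, pow_one, pow_one] at h
  rw [h]
  exact (algebraMap_smul QTSeries c (xVar ab.1 * yVar ab.2)).symm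

theorem hasLogDeriv_qPochFactor (c : QT) (ab : (Fin n × ℕ) × (Fin n × ℕ)) (m : ℕ) :
    HasLogDeriv (diag (pairExp ab) fun r => -algebraMap QT QTSeries ((q ^ m * c) ^ (r : ℕ)))
      (qPochFactor (c • (xVar ab.1 * yVar ab.2)) m) := by
  have h := hasLogDeriv_one_sub_monomial (degree_pairExp ab) (algebraMap QT QTSeries (q ^ m * c))
  rw [diag_neg] at h
  rw [qPochFactor, smul_smul, smul_xVar_mul_yVar]
  simp only [map_pow] at h ⊢
  exact h

/-- Summing (q^m c)^r over m is a geometric series with ratio q^r. The cases c = t and c = 1 give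
numerator and denominator of `macFactor`. -/
theorem hasLogDeriv_qPoch (c : QT) (ab : (Fin n × ℕ) × (Fin n × ℕ)) :
    Multipliable (qPochFactor (c • (xVar ab.1 * yVar ab.2))) ∧
      HasLogDeriv (diag (pairExp ab) fun r => -algebraMap QT QTSeries
        (c ^ (r : ℕ) / (1 - q ^ (r : ℕ)))) (qPoch (c • (xVar ab.1 * yVar ab.2))) := by
  refine hasLogDeriv_tprod (fun m => hasLogDeriv_qPochFactor c ab m) (hasSum_diag _ fun r => ?_)
  have h := ((hasSum_q_pow r).mul_left (algebraMap QT QTSeries (c ^ (r : ℕ)))).neg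
  rw [← map_mul, ← div_eq_mul_inv] at h
  have h1 : (fun m : ℕ => -algebraMap QT QTSeries ((q ^ m * c) ^ (r : ℕ))) = fun m =>
      -(algebraMap QT QTSeries (c ^ (r : ℕ)) * (algebraMap QT QTSeries q ^ m) ^ (r : ℕ)) := by
    funext m
    rw [← map_pow, ← map_pow, ← map_mul]
    congr 2
    ring
  rw [h1]
  exact h

theorem hasLogDeriv_macFactor {k : Fin n} (hk : (k : ℕ) + 1 = n)
    (ab : (Fin n × ℕ) × (Fin n × ℕ)) :
    HasLogDeriv (diag (pairExp ab) fun r => algebraMap QT QTSeries (kerCoef k r))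
      (macFactor ab) := by
  have h1 := (hasLogDeriv_qPoch t ab).2
  have h2 := (hasLogDeriv_qPoch 1 ab).2
  rw [one_smul] at h2
  have h3 := h1.mul h2.inv
  rw [diag_neg, diag_add] at h3
  unfold macFactor
  convert h3 using 2
  funext r
  simp only [Pi.add_apply, Pi.neg_apply, neg_neg, kerCoef, if_pos hk]
  rw [← map_neg, ← map_add]
  congr 1
  ring

theorem hasLogDeriv_cauchyFactor {k : Fin n} (hk : (k : ℕ) + 1 ≠ n) (ab : UpTo k × UpTo k) :
    HasLogDeriv (diag (pairExp (Prod.map Subtype.val Subtype.val ab))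
      fun r => algebraMap QT QTSeries (kerCoef k r)) (cauchyFactor k ab) := by
  have h := (hasLogDeriv_one_sub_monomial (degree_pairExp (Prod.map Subtype.val Subtype.val ab))
    (algebraMap QT QTSeries (q ^ (-((n : ℤ) - ((k : ℤ) + 1)))))).inv
  rw [neg_neg, ← smul_xVar_mul_yVar] at h
  simp only [kerCoef, if_neg hk, map_pow] at h ⊢
  exact h

/-- The series `∑_r c_r p_r(x^(1),…,x^(k)) p_r(y^(1),…,y^(k))`. -/
def kerSum (k : Fin n) : SeriesXY n :=
  cauchySum (Subtype.val : UpTo k → Fin n × ℕ) fun r => algebraMap QT QTSeries (kerCoef k r)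

/-- The product `p_r(x^(1),…,x^(k)) p_r(y^(1),…,y^(k))`. -/
def pairSum (k : Fin n) (r : ℕ+) : SeriesXY n :=
  powerSum QTSeries (⋃ j ≤ k, xAlphabet n j) r * powerSum QTSeries (⋃ j ≤ k, yAlphabet n j) r

theorem iUnion_xAlphabet (k : Fin n) :
    (⋃ j ≤ k, xAlphabet n j) = Set.range (Sum.inl ∘ (Subtype.val : UpTo k → Fin n × ℕ)) := by
  ext v
  simp [xAlphabet, stdAlphabet]

theorem iUnion_yAlphabet (k : Fin n) :
    (⋃ j ≤ k, yAlphabet n j) = Set.range (Sum.inr ∘ (Subtype.val : UpTo k → Fin n × ℕ)) := by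
  ext v
  simp [yAlphabet, stdAlphabet]

theorem hasSum_kerSum (k : Fin n) : HasSum (fun r => kerCoef k r • pairSum k r) (kerSum k) := by
  have h := hasSum_powerSum_mul_powerSum Subtype.val_injective (iUnion_xAlphabet k)
    (iUnion_yAlphabet k) fun r => algebraMap QT QTSeries (kerCoef k r)
  simp only [algebraMap_smul] at h
  exact h

/-- For the last `k`, `UpTo k` contains all variables. The index types still differ, so both sides
are identified as sums of the same series in power sums. -/
theorem cauchySum_id {k : Fin n} (hk : (k : ℕ) + 1 = n) :
    cauchySum id (fun r => algebraMap QT QTSeries (kerCoef k r)) = kerSum k := by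
  have hle : ∀ j : Fin n, j ≤ k := fun j => Fin.le_def.2 (by omega)
  have h := hasSum_powerSum_mul_powerSum (S := ⋃ j ≤ k, xAlphabet n j)
    (T := ⋃ j ≤ k, yAlphabet n j) (Function.injective_id (α := Fin n × ℕ))
    (by ext v; simp [xAlphabet, stdAlphabet, hle]) (by ext v; simp [yAlphabet, stdAlphabet, hle])
    fun r => algebraMap QT QTSeries (kerCoef k r)
  exact h.unique (hasSum_powerSum_mul_powerSum Subtype.val_injective (iUnion_xAlphabet k)
    (iUnion_yAlphabet k) fun r => algebraMap QT QTSeries (kerCoef k r))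

theorem macFactor_tprod {k : Fin n} (hk : (k : ℕ) + 1 = n) :
    Multipliable (macFactor (n := n)) ∧
      HasLogDeriv (kerSum k) (∏' ab : (Fin n × ℕ) × (Fin n × ℕ), macFactor ab) := by
  rw [← cauchySum_id hk]
  exact hasLogDeriv_tprod (fun ab => hasLogDeriv_macFactor hk ab)
    (hasSum_diag_cauchySum Function.injective_id _)

theorem cauchyFactor_tprod {k : Fin n} (hk : (k : ℕ) + 1 ≠ n) :
    Multipliable (cauchyFactor k) ∧
      HasLogDeriv (kerSum k) (∏' ab : UpTo k × UpTo k, cauchyFactor k ab) :=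
  hasLogDeriv_tprod (fun ab => hasLogDeriv_cauchyFactor hk ab)
    (hasSum_diag_cauchySum Subtype.val_injective _)

theorem kernelConverges (hn : 1 ≤ n) : KernelConverges n := by
  refine ⟨fun a b => ⟨(hasLogDeriv_qPoch t (a, b)).1, ?_⟩,
    (macFactor_tprod (k := ⟨n - 1, by omega⟩) (Nat.sub_add_cancel hn)).1,
    fun k hk => (cauchyFactor_tprod hk.ne).1⟩
  have h := (hasLogDeriv_qPoch 1 (a, b)).1
  rwa [one_smul] at h

theorem hasLogDeriv_kernel (hn : 1 ≤ n) : HasLogDeriv (∑ k : Fin n, kerSum k) (kernel n) := by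
  have hk : ((⟨n - 1, by omega⟩ : Fin n) : ℕ) + 1 = n := Nat.sub_add_cancel hn
  have h1 : Finset.univ.filter (fun k : Fin n => ¬ (k : ℕ) + 1 < n) = {⟨n - 1, by omega⟩} := by
    ext k
    simp only [Finset.mem_filter, Finset.mem_univ, true_and, Finset.mem_singleton, Fin.ext_iff]
    omega
  rw [← Finset.sum_filter_add_sum_filter_not Finset.univ fun k : Fin n => (k : ℕ) + 1 < n, h1,
    Finset.sum_singleton, add_comm]
  exact (macFactor_tprod hk).2.mul (HasLogDeriv.prod _ fun k hk =>
    (cauchyFactor_tprod (Finset.mem_filter.1 hk).2.ne).2)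

end Kernel

/-! ### The norms of the power sums -/

section Norm

open Finset

theorem Ptn.z_eq_prod {l : Ptn} {s : Finset ℕ+} (hs : l.toFinset ⊆ s) :
    l.z = ∏ i ∈ s, (i : ℕ) ^ l.count i * (l.count i).factorial :=
  prod_subset hs fun i _ hi => by
    rw [Multiset.mem_toFinset] at hi
    simp [Multiset.count_eq_zero_of_notMem hi]

theorem Ptn.z_add_singleton (l : Ptn) (r : ℕ+) :
    Ptn.z (l + {r}) = l.z * (r * (l.count r + 1)) := by
  rw [Ptn.z, Ptn.z_eq_prod (l := l) (s := (l + {r} : Ptn).toFinset)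
    fun i hi => by simp only [Multiset.mem_toFinset, Multiset.mem_add] at hi ⊢; exact Or.inl hi]
  have hr : r ∈ (l + {r} : Ptn).toFinset := by simp
  rw [← mul_prod_erase _ _ hr, ← mul_prod_erase _ _ hr]
  have h : ∀ i ∈ (l + {r} : Ptn).toFinset.erase r, (l + {r} : Ptn).count i = l.count i := by
    intro i hi
    rw [Multiset.count_add, Multiset.count_singleton, if_neg (mem_erase.1 hi).1, add_zero]
  rw [prod_congr rfl fun i hi => by rw [h i hi]]
  rw [Multiset.count_add, Multiset.count_singleton_self, pow_succ, Nat.factorial_succ]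
  ring

theorem Ptn.z_ne_zero (l : Ptn) : l.z ≠ 0 :=
  prod_ne_zero_iff.2 fun i _ => mul_ne_zero (pow_ne_zero _ i.ne_zero) (Nat.factorial_ne_zero _)

theorem Ptn.size_cons (r : ℕ+) (l : Ptn) : Ptn.size (r ::ₘ l) = r + l.size := by
  simp [Ptn.size]

theorem Ptn.card_le_size (l : Ptn) : l.card ≤ l.size := by
  induction l using Multiset.induction_on with
  | empty => exact le_rfl
  | cons r l ih =>
    rw [Ptn.size_cons, Multiset.card_cons, add_comm]
    exact add_le_add r.pos ih

theorem Ptn.le_size {l : Ptn} {r : ℕ+} (hr : r ∈ l) : (r : ℕ) ≤ l.size := by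
  obtain ⟨m, rfl⟩ := Multiset.exists_cons_of_mem hr
  rw [Ptn.size_cons]
  exact Nat.le_add_right _ _

theorem prod_map_inv_kerCoef (k : Fin n) (l : Ptn) :
    (l.map fun r => (kerCoef k r)⁻¹).prod = q ^ (((n : ℤ) - ((k : ℤ) + 1)) * (l.size : ℤ)) *
      if (k : ℕ) + 1 = n then
        (l.map fun r : ℕ+ => (1 - q ^ (r : ℕ)) / (1 - t ^ (r : ℕ))).prod else 1 := by
  by_cases hk : (k : ℕ) + 1 = n
  · have h : (n : ℤ) - ((k : ℤ) + 1) = 0 := by omega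
    simp only [kerCoef, if_pos hk, inv_div, h, zero_mul, zpow_zero, one_mul]
  · simp only [kerCoef, if_neg hk, mul_one]
    induction l using Multiset.induction_on with
    | empty => simp [Ptn.size]
    | cons r l ih =>
      rw [Multiset.map_cons, Multiset.prod_cons, ih, Ptn.size_cons, Nat.cast_add, mul_add,
        zpow_add₀ q_ne_zero, ← inv_pow, ← zpow_neg, neg_neg, zpow_mul _ _ (r : ℤ),
        zpow_natCast]

theorem prod_zpow_eq_zpow_sum {K ι : Type*} [Field K] {a : K} (ha : a ≠ 0) (s : Finset ι)
    (f : ι → ℤ) : ∏ i ∈ s, a ^ f i = a ^ ∑ i ∈ s, f i := by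
  classical
  induction s using Finset.induction_on with
  | empty => simp
  | insert i s hi ih => rw [prod_insert hi, sum_insert hi, ih, zpow_add₀ ha]

/-- The power of q distributes over components, with exponent (n - (k+1)) |λ^(k)| for the zero-based
`k`. It vanishes at the last component, the only one carrying the factors (1 - q^r)/(1 - t^r). -/
theorem zNorm_eq_prod (la : MultiPtn n) :
    zNorm la = ∏ k, (((la k).z : QT) * ((la k).map fun r => (kerCoef k r)⁻¹).prod) := by
  simp only [prod_map_inv_kerCoef]
  rw [prod_mul_distrib, prod_mul_distrib, prod_zpow_eq_zpow_sum q_ne_zero, zNorm, ← prod_filter]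
  have h : ((n : ℤ) - 1) * (∑ k : Fin n, ((la k).size : ℤ)) -
      ∑ k : Fin n, (k : ℤ) * ((la k).size : ℤ) =
      ∑ k : Fin n, ((n : ℤ) - ((k : ℤ) + 1)) * ((la k).size : ℤ) := by
    rw [mul_sum, ← sum_sub_distrib]
    exact sum_congr rfl fun k _ => by ring
  rw [h]
  ring

theorem zNorm_ne_zero (la : MultiPtn n) : zNorm la ≠ 0 := by
  rw [zNorm_eq_prod]
  refine prod_ne_zero_iff.2 fun k _ => mul_ne_zero (Nat.cast_ne_zero.2 (Ptn.z_ne_zero _)) ?_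
  refine Multiset.prod_ne_zero fun h => ?_
  obtain ⟨r, -, hr⟩ := Multiset.mem_map.1 h
  exact inv_ne_zero (kerCoef_ne_zero k r) hr

theorem zNorm_zero : zNorm (0 : MultiPtn n) = 1 := by
  simp [zNorm_eq_prod, Ptn.z]

/-- A product over the components changes only in the factor at which a part is added. -/
theorem prod_add_single {M : Type*} [CommMonoid M] (F : Fin n → Ptn → M) (la : MultiPtn n)
    (k : Fin n) (r : ℕ+) {c d : M} (h : F k (la k + {r}) * c = d * F k (la k)) :
    (∏ j, F j ((la + Pi.single k {r} : MultiPtn n) j)) * c = d * ∏ j, F j (la j) := by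
  rw [← mul_prod_erase univ _ (mem_univ k), ← mul_prod_erase univ (fun j => F j (la j))
    (mem_univ k), Pi.add_apply, Pi.single_eq_same]
  have h1 : ∏ j ∈ univ.erase k, F j ((la + Pi.single k {r} : MultiPtn n) j) =
      ∏ j ∈ univ.erase k, F j (la j) := prod_congr rfl fun j hj => by
    rw [Pi.add_apply, Pi.single_eq_of_ne (mem_erase.1 hj).1, add_zero]
  rw [h1, mul_right_comm, h, mul_assoc]

/-- Adding a part `r` multiplies the integer z of the component by r (m_r + 1) and the rest by
(c_{k,r})⁻¹. This recursion encodes the differential equation E f = L f. -/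
theorem zNorm_add_single (la : MultiPtn n) (k : Fin n) (r : ℕ+) :
    zNorm (la + Pi.single k {r}) * kerCoef k r =
      ((r : ℕ) * ((la k).count r + 1) : QT) * zNorm la := by
  rw [zNorm_eq_prod, zNorm_eq_prod]
  refine prod_add_single (fun j (l : Ptn) => (l.z : QT) *
    (l.map fun r => (kerCoef j r)⁻¹).prod) la k r ?_
  simp only [Ptn.z_add_singleton, Multiset.map_add, Multiset.prod_add, Multiset.map_singleton,
    Multiset.prod_singleton]
  push_cast
  rw [← mul_assoc, mul_assoc _ (kerCoef k r)⁻¹, inv_mul_cancel₀ (kerCoef_ne_zero k r)]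
  ring

end Norm

/-! ### Homogeneity -/

section Homogeneous

open MvPowerSeries Finset

/-- The total degree of a multi-partition. -/
def MultiPtn.size (la : MultiPtn n) : ℕ := ∑ k, (la k).size

variable {σ : Type*} {R : Type*} [CommRing R]

/-- Only monomials of degree `d` occur in `f`. -/
def IsHomog (d : ℕ) (f : MvPowerSeries σ R) : Prop := ∀ e, coeff e f ≠ 0 → e.degree = d

theorem isHomog_one : IsHomog 0 (1 : MvPowerSeries σ R) := by
  classical
  intro e he
  rw [coeff_one] at he
  have h : e = 0 := by
    by_contra h
    exact he (if_neg h)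
  simp [h]

theorem IsHomog.mul {c d : ℕ} {f g : MvPowerSeries σ R} (hf : IsHomog c f) (hg : IsHomog d g) :
    IsHomog (c + d) (f * g) := by
  classical
  intro e he
  rw [coeff_mul] at he
  obtain ⟨p, hp, h⟩ := exists_ne_zero_of_sum_ne_zero he
  rw [← mem_antidiagonal.1 hp, map_add, hf _ (left_ne_zero_of_mul h),
    hg _ (right_ne_zero_of_mul h)]

theorem IsHomog.prod {ι : Type*} {d : ι → ℕ} {f : ι → MvPowerSeries σ R} (s : Finset ι)
    (h : ∀ i ∈ s, IsHomog (d i) (f i)) : IsHomog (∑ i ∈ s, d i) (∏ i ∈ s, f i) := by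
  classical
  induction s using Finset.induction_on with
  | empty => exact isHomog_one
  | insert i s hi ih =>
    rw [sum_insert hi, prod_insert hi]
    exact (h i (mem_insert_self i s)).mul (ih fun j hj => h j (mem_insert_of_mem hj))

theorem isHomog_powerSum (S : Set σ) (r : ℕ+) : IsHomog r (powerSum R S r) := by
  intro e he
  by_cases h : ∃ v ∈ S, e = Finsupp.single v (r : ℕ)
  · obtain ⟨v, -, rfl⟩ := h
    simp
  · exact absurd (if_neg h) he

theorem isHomog_pMulti (A : Fin n → Set σ) (la : MultiPtn n) :
    IsHomog la.size (pMulti R A la) := by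
  refine IsHomog.prod _ fun k _ => ?_
  induction la k using Multiset.induction_on with
  | empty => exact isHomog_one
  | cons r l ih =>
    rw [Ptn.size_cons, Multiset.map_cons, Multiset.prod_cons]
    exact (isHomog_powerSum _ r).mul ih

theorem finite_size_eq (d : ℕ) : {la : MultiPtn n | la.size = d}.Finite := by
  classical
  have h : {l : Ptn | l.size ≤ d}.Finite := by
    -- A partition of size at most `d` has at most `d` parts, each at most `d`, so it lies in `d`
    -- copies of the interval. The bound `d + 1` keeps the endpoint positive when `d = 0`.
    refine (Set.finite_Iic (d • (Finset.Icc 1 d.succPNat).val)).subset fun l hl => ?_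
    rw [Set.mem_Iic, Multiset.le_iff_count]
    intro r
    by_cases hr : r ∈ l
    · have h1 : r ∈ (Finset.Icc 1 d.succPNat).val := by
        rw [Finset.mem_val, Finset.mem_Icc]
        exact ⟨one_le, ((Ptn.le_size hr).trans hl).trans (Nat.le_succ d)⟩
      rw [Multiset.count_nsmul, Multiset.count_eq_one_of_mem (Finset.nodup _) h1, mul_one]
      exact (Multiset.count_le_card r l).trans ((Ptn.card_le_size l).trans hl)
    · simp [Multiset.count_eq_zero_of_notMem hr]
  refine (Set.Finite.pi' fun _ : Fin n => h).subset fun la hla k => ?_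
  exact (single_le_sum (f := fun k => (la k).size) (fun _ _ => Nat.zero_le _) (mem_univ k)).trans
    (le_of_eq hla)

end Homogeneous

/-! ### The expansion of the kernel in power sums -/

section Expansion

open MvPowerSeries Finset

/-- The summand `z_λ(q,t)⁻¹ p_λ(x) p_λ(y)`. -/
def expTerm (la : MultiPtn n) : SeriesXY n :=
  (zNorm la)⁻¹ • (pMulti QTSeries (xAlphabet n) la * pMulti QTSeries (yAlphabet n) la)

theorem pMulti_mul_pMulti (la : MultiPtn n) :
    pMulti QTSeries (xAlphabet n) la * pMulti QTSeries (yAlphabet n) la =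
      ∏ k, ((la k).map (pairSum k)).prod := by
  rw [pMulti, pMulti, ← prod_mul_distrib]
  exact prod_congr rfl fun k _ => Multiset.prod_map_mul.symm

theorem expTerm_add_single (la : MultiPtn n) (k : Fin n) (r : ℕ+) :
    ((r : ℕ) * ((la k).count r + 1)) • expTerm (la + Pi.single k {r}) =
      (kerCoef k r • pairSum k r) * expTerm la := by
  have h := prod_add_single (fun j (l : Ptn) => (l.map (pairSum j)).prod) la k r
    (c := 1) (d := pairSum k r)
    (by simp [mul_comm])
  rw [mul_one] at h
  have hz := zNorm_add_single la k r
  have h0 := zNorm_ne_zero la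
  have h1 := zNorm_ne_zero (la + Pi.single k {r})
  rw [expTerm, expTerm, pMulti_mul_pMulti, pMulti_mul_pMulti, h, smul_mul_smul_comm,
    ← Nat.cast_smul_eq_nsmul QT, smul_smul]
  congr 1
  push_cast
  field_simp
  linear_combination -hz

theorem coeff_qt_smul {σ : Type*} (e : σ →₀ ℕ) (c : QT) (f : MvPowerSeries σ QTSeries) :
    coeff e (c • f) = algebraMap QT QTSeries c * coeff e f :=
  Algebra.smul_def c (coeff e f)

theorem isHomog_expTerm (la : MultiPtn n) : IsHomog (la.size + la.size) (expTerm la) := by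
  intro e he
  rw [expTerm, coeff_qt_smul] at he
  exact ((isHomog_pMulti _ la).mul (isHomog_pMulti _ la)) e (right_ne_zero_of_mul he)

/-- The term has degree |λ| in x and in y, hence 2|λ| in total, which `euler` halves. -/
theorem euler_expTerm (la : MultiPtn n) : euler (expTerm la) = la.size • expTerm la := by
  ext e : 1
  rw [coeff_euler, map_nsmul, nsmul_eq_mul]
  by_cases he : coeff e (expTerm la) = 0
  · simp [he]
  · rw [isHomog_expTerm la e he]
    push_cast
    ring

theorem summable_expTerm : Summable (expTerm (n := n)) :=
  summable_of_finite_coeff fun e => (finite_size_eq (e.degree / 2)).subset fun la hla => by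
    have := isHomog_expTerm la e hla
    simp only [Set.mem_ofPred_eq]
    omega

/-- The part `r` of `λ^(k)` contributes `r m_r(λ^(k))` to `|λ|`. -/
def partTerm (x : MultiPtn n × (Fin n × ℕ+)) : SeriesXY n :=
  ((x.2.2 : ℕ) * (x.1 x.2.1).count x.2.2) • expTerm x.1

theorem summable_partTerm : Summable (partTerm (n := n)) := by
  refine summable_of_finite_coeff fun e => ((finite_size_eq (n := n) (e.degree / 2)).prod
    (Set.finite_univ.prod (Set.finite_Iic e.degree.succPNat))).subset ?_
  rintro ⟨la, k, r⟩ h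
  simp only [Set.mem_ofPred_eq, partTerm] at h
  have h1 := isHomog_expTerm la e fun h1 => h (by rw [map_nsmul, h1, smul_zero])
  have h2 : r ∈ la k := by
    by_contra h2
    exact h (by simp [Multiset.count_eq_zero_of_notMem h2])
  refine ⟨?_, Set.mem_univ _, ?_⟩
  · simp only [Set.mem_ofPred_eq]
    omega
  · have h3 : (la k).size ≤ la.size :=
      single_le_sum (f := fun k => (la k).size) (fun _ _ => Nat.zero_le _) (mem_univ k)
    have h4 := Ptn.le_size h2
    rw [Set.mem_Iic, ← PNat.coe_le_coe, Nat.succPNat_coe]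
    dsimp only
    omega

theorem hasSum_partTerm (la : MultiPtn n) :
    HasSum (fun kr : Fin n × ℕ+ => partTerm (la, kr)) (euler (expTerm la)) := by
  classical
  set S : Finset ℕ+ := univ.biUnion fun k => (la k).toFinset
  have h : euler (expTerm la) = ∑ kr ∈ univ ×ˢ S, partTerm (la, kr) := by
    rw [euler_expTerm, sum_product]
    simp only [partTerm, ← sum_smul]
    congr 1
    refine sum_congr rfl fun k _ => ?_
    rw [Ptn.size, Finset.sum_multiset_map_count]
    refine (sum_subset (subset_biUnion_of_mem (fun k => (la k).toFinset) (mem_univ k))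
      fun r _ hr => ?_).trans (sum_congr rfl fun r _ => mul_comm _ _)
    rw [Multiset.count_eq_zero_of_notMem fun h => hr (Multiset.mem_toFinset.2 h), zero_smul]
  rw [h]
  refine hasSum_sum_of_ne_finset_zero fun kr hkr => ?_
  have h1 : kr.2 ∉ la kr.1 := fun h1 => hkr (mem_product.2 ⟨mem_univ _,
    mem_biUnion.2 ⟨kr.1, mem_univ _, Multiset.mem_toFinset.2 h1⟩⟩)
  rw [partTerm, Multiset.count_eq_zero_of_notMem h1, mul_zero, zero_nsmul]

/-- Adding a part `r` to `λ^(k)`. -/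
def addPart (x : MultiPtn n × (Fin n × ℕ+)) : MultiPtn n × (Fin n × ℕ+) :=
  (x.1 + Pi.single x.2.1 {x.2.2}, x.2)

theorem addPart_injective : Function.Injective (addPart (n := n)) := by
  rintro ⟨la, k, r⟩ ⟨mu, k', r'⟩ h
  obtain ⟨h1, h2⟩ := Prod.ext_iff.1 h
  obtain ⟨rfl, rfl⟩ := Prod.mk.inj h2
  rw [Prod.mk.injEq]
  exact ⟨add_right_cancel h1, rfl⟩

theorem partTerm_addPart (la : MultiPtn n) (kr : Fin n × ℕ+) :
    partTerm (addPart (la, kr)) = (kerCoef kr.1 kr.2 • pairSum kr.1 kr.2) * expTerm la := by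
  rw [← expTerm_add_single]
  simp [partTerm, addPart]

/-- Outside the range of `addPart`, `r` is not a part of the `k`-th component, so its multiplicity
is zero. -/
theorem partTerm_eq_zero {x : MultiPtn n × (Fin n × ℕ+)} (hx : x ∉ Set.range (addPart (n := n))) :
    partTerm x = 0 := by
  classical
  obtain ⟨la, k, r⟩ := x
  have h : r ∉ la k := by
    intro h
    refine hx ⟨(Function.update la k ((la k).erase r), k, r), ?_⟩
    rw [addPart, Prod.mk.injEq]
    refine ⟨funext fun j => ?_, rfl⟩
    by_cases hj : j = k
    · subst hj
      simp only [Pi.add_apply, Function.update_self, Pi.single_eq_same]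
      rw [add_comm, Multiset.singleton_add, Multiset.cons_erase h]
    · simp [hj]
  rw [partTerm, Multiset.count_eq_zero_of_notMem h, mul_zero, zero_nsmul]

/-- Double counting of `partTerm`: summing over (k, r) first gives `euler` of each term, while
reindexing along `addPart` and summing over λ first gives c_{k,r} p_r p_r times the whole series. -/
theorem euler_tsum_expTerm :
    euler (∑' la : MultiPtn n, expTerm la) =
      (∑ k : Fin n, kerSum k) * ∑' la : MultiPtn n, expTerm la := by
  have hT := (summable_partTerm (n := n)).hasSum
  have h1 := hT.prod_fiberwise fun la => hasSum_partTerm la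
  have h2 := (hasSum_euler (summable_expTerm (n := n)).hasSum).unique h1
  have h3 := (addPart_injective.hasSum_iff fun x hx => partTerm_eq_zero hx).2 hT
  rw [← (Equiv.prodComm (Fin n × ℕ+) (MultiPtn n)).hasSum_iff] at h3
  have h4 := h3.prod_fiberwise (g := fun kr : Fin n × ℕ+ =>
      (kerCoef kr.1 kr.2 • pairSum kr.1 kr.2) * ∑' la : MultiPtn n, expTerm la) fun kr => by
    have h5 := (summable_expTerm (n := n)).hasSum.mul_left (kerCoef kr.1 kr.2 • pairSum kr.1 kr.2)
    simp only [Function.comp_apply, Equiv.prodComm_apply, Prod.swap_prod_mk, partTerm_addPart]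
    exact h5
  have h6 := h4.prod_fiberwise (g := fun k => kerSum k * ∑' la : MultiPtn n, expTerm la)
    fun k => (hasSum_kerSum k).mul_right _
  rw [h2, h6.unique (hasSum_fintype _), sum_mul]

theorem constantCoeff_tsum_expTerm :
    constantCoeff (∑' la : MultiPtn n, expTerm la) = 1 := by
  have h := WithPiTopology.hasSum_iff_hasSum_coeff.1 (summable_expTerm (n := n)).hasSum 0
  refine h.unique ?_
  have h0 : coeff 0 (expTerm (0 : MultiPtn n)) = 1 := by
    simp [expTerm, zNorm_zero, pMulti]
  rw [← h0]
  refine hasSum_single 0 fun la hla => ?_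
  by_contra h1
  have h2 := isHomog_expTerm la 0 h1
  have h3 : la.size = 0 := by
    rw [map_zero] at h2
    omega
  refine hla (funext fun k => ?_)
  have h4 := Ptn.card_le_size (la k)
  rw [sum_eq_zero_iff.1 h3 k (mem_univ k)] at h4
  exact Multiset.card_eq_zero.1 (Nat.le_zero.1 h4)

theorem hasSum_kernel (hn : 1 ≤ n) : HasSum expTerm (kernel n) := by
  have h : HasLogDeriv (∑ k : Fin n, kerSum k) (∑' la : MultiPtn n, expTerm la) :=
    ⟨euler_tsum_expTerm, constantCoeff_tsum_expTerm⟩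
  rw [(hasLogDeriv_kernel hn).eq h]
  exact summable_expTerm.hasSum

end Expansion

/-! ### The reproducing property -/

section Reproducing

open MvPowerSeries Finset

theorem sumElim_injective {α β : Type*} {a a' : α →₀ ℕ} {b b' : β →₀ ℕ}
    (h : Finsupp.sumElim a b = Finsupp.sumElim a' b') : a = a' ∧ b = b' :=
  ⟨Finsupp.ext fun v => DFunLike.congr_fun h (Sum.inl v),
    Finsupp.ext fun v => DFunLike.congr_fun h (Sum.inr v)⟩

/-- The two factors use disjoint variables, so only one splitting of the exponent contributes. -/
theorem coeff_sumElim_rename_mul_rename {α β R : Type*} [CommRing R] (f : MvPowerSeries α R)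
    (g : MvPowerSeries β R) (a : α →₀ ℕ) (b : β →₀ ℕ) :
    coeff (Finsupp.sumElim a b) (rename (Function.Embedding.inl (β := β)) f *
      rename (Function.Embedding.inr (α := α)) g) = coeff a f * coeff b g := by
  classical
  rw [coeff_mul, sum_eq_single (Finsupp.mapDomain Sum.inl a, Finsupp.mapDomain Sum.inr b)]
  · congr 1
    · rw [← coeff_embDomain_rename Function.Embedding.inl f a, Finsupp.embDomain_eq_mapDomain]
      rfl
    · rw [← coeff_embDomain_rename Function.Embedding.inr g b, Finsupp.embDomain_eq_mapDomain]
      rfl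
  · rintro ⟨c, d⟩ hp hne
    rw [HasAntidiagonal.mem_antidiagonal] at hp
    by_contra h
    have hc : c ∈ Set.range (Finsupp.mapDomain (Function.Embedding.inl (α := α) (β := β))) := by
      by_contra hc
      exact h (by rw [coeff_rename_eq_zero _ f hc, zero_mul])
    have hd : d ∈ Set.range (Finsupp.mapDomain (Function.Embedding.inr (α := α) (β := β))) := by
      by_contra hd
      exact h (by rw [coeff_rename_eq_zero _ g hd, mul_zero])
    obtain ⟨a', rfl⟩ := hc
    obtain ⟨b', rfl⟩ := hd
    obtain ⟨rfl, rfl⟩ := sumElim_injective ((Finsupp.sumElim_eq_add a' b').trans hp)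
    exact hne rfl
  · intro h
    exact absurd (HasAntidiagonal.mem_antidiagonal.2 (Finsupp.sumElim_eq_add a b).symm) h

theorem rename_map_powerSum {σ τ R S : Type*} [CommRing R] [CommRing S] (φ : R →+* S) (e : σ ↪ τ)
    (A : Set σ) (r : ℕ+) :
    rename e (map φ (powerSum R A r)) = powerSum S (e '' A) r := by
  classical
  ext d
  by_cases hd : d ∈ Set.range (Finsupp.mapDomain e)
  · obtain ⟨d, rfl⟩ := hd
    rw [← Finsupp.embDomain_eq_mapDomain, coeff_embDomain_rename, coeff_map]
    change φ (if _ then _ else _) = if _ then _ else _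
    have h : (∃ v ∈ A, d = Finsupp.single v (r : ℕ)) ↔
        ∃ v ∈ e '' A, Finsupp.embDomain e d = Finsupp.single v (r : ℕ) := by
      simp only [Set.exists_mem_image, ← Finsupp.embDomain_single,
        (Finsupp.embDomain_injective e).eq_iff]
    rw [apply_ite φ, map_one, map_zero]
    exact if_congr h rfl rfl
  · rw [coeff_rename_eq_zero _ _ hd]
    refine (if_neg ?_).symm
    rintro ⟨_, ⟨v, -, rfl⟩, rfl⟩
    exact hd ⟨Finsupp.single v (r : ℕ), Finsupp.mapDomain_single⟩

theorem rename_map_pMulti {σ τ R S : Type*} [CommRing R] [CommRing S] (φ : R →+* S) (e : σ ↪ τ)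
    (A : Fin n → Set σ) (la : MultiPtn n) :
    rename e (map φ (pMulti R A la)) = pMulti S (fun k => e '' A k) la := by
  simp only [pMulti, map_prod, map_multiset_prod, Multiset.map_map, Function.comp_def,
    rename_map_powerSum, Set.image_iUnion]

theorem rename_map_eval {σ τ : Type*} (e : σ ↪ τ) (A : Fin n → Set σ) (f : MultiSym n) :
    rename e (map (algebraMap QT QTSeries) (f.eval QT A)) =
      f.eval QTSeries fun k => e '' A k := by
  rw [MultiSym.eval, MultiSym.eval, Finsupp.sum, Finsupp.sum, map_sum, map_sum]
  refine sum_congr rfl fun la _ => ?_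
  rw [← rename_map_pMulti (algebraMap QT QTSeries)]
  have h : map (algebraMap QT QTSeries) (f la • pMulti QT A la) =
      algebraMap QT QTSeries (f la) • map (algebraMap QT QTSeries) (pMulti QT A la) := by
    ext d : 1
    rw [coeff_map, coeff_smul, coeff_smul, coeff_map, map_mul]
  rw [h, map_smul, algebraMap_smul]

theorem coeff_eval_mul_eval (f g : MultiSym n) (a b : Fin n × ℕ →₀ ℕ) :
    coeff (Finsupp.sumElim a b) (f.eval QTSeries (xAlphabet n) * g.eval QTSeries (yAlphabet n)) =
      algebraMap QT QTSeries (coeff a (f.eval QT (stdAlphabet n)) *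
        coeff b (g.eval QT (stdAlphabet n))) := by
  have hx := rename_map_eval Function.Embedding.inl (stdAlphabet n) f (τ := XY n)
  have hy := rename_map_eval Function.Embedding.inr (stdAlphabet n) g (τ := XY n)
  rw [map_mul (algebraMap QT QTSeries), ← coeff_map, ← coeff_map, ← coeff_sumElim_rename_mul_rename, hx, hy]
  rfl

theorem eval_single {σ : Type*} (R : Type*) [CommRing R] [Algebra QT R] (A : Fin n → Set σ)
    (la : MultiPtn n) : MultiSym.eval R A (Finsupp.single la 1) = pMulti R A la := by
  rw [MultiSym.eval, Finsupp.sum_single_index (zero_smul QT (pMulti R A la)), one_smul]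

theorem coeff_expTerm (la : MultiPtn n) (a b : Fin n × ℕ →₀ ℕ) :
    coeff (Finsupp.sumElim a b) (expTerm la) = algebraMap QT QTSeries ((zNorm la)⁻¹ *
      (coeff a (pMulti QT (stdAlphabet n) la) * coeff b (pMulti QT (stdAlphabet n) la))) := by
  rw [expTerm, coeff_qt_smul, map_mul (algebraMap QT QTSeries), ← eval_single QT, ← coeff_eval_mul_eval, eval_single,
    eval_single]

theorem coeff_eval (f : MultiSym n) (b : Fin n × ℕ →₀ ℕ) :
    coeff b (f.eval QT (stdAlphabet n)) = f.sum fun la c =>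
      c * coeff b (pMulti QT (stdAlphabet n) la) := by
  rw [MultiSym.eval, Finsupp.sum, map_sum]
  rfl

/-- The coefficient of `y^b` in the kernel, `∑_λ z_λ(q,t)⁻¹ [y^b] p_λ(y) p_λ(x)`. -/
def kernelCoeff (b : Fin n × ℕ →₀ ℕ) : MultiSym n :=
  Finsupp.onFinset (finite_size_eq b.degree).toFinset
    (fun la => (zNorm la)⁻¹ * coeff b (pMulti QT (stdAlphabet n) la)) fun la h =>
      (Set.Finite.mem_toFinset _).2 (isHomog_pMulti _ la b (right_ne_zero_of_mul h)).symm

theorem kernelCoeff_apply (b : Fin n × ℕ →₀ ℕ) (la : MultiPtn n) :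
    kernelCoeff b la = (zNorm la)⁻¹ * coeff b (pMulti QT (stdAlphabet n) la) := rfl

theorem coeff_kernel (hn : 1 ≤ n) (a b : Fin n × ℕ →₀ ℕ) :
    coeff (Finsupp.sumElim a b) (kernel n) =
      algebraMap QT QTSeries (coeff a ((kernelCoeff b).eval QT (stdAlphabet n))) := by
  have h := WithPiTopology.hasSum_iff_hasSum_coeff.1 (hasSum_kernel hn) (Finsupp.sumElim a b)
  refine h.unique ?_
  rw [coeff_eval, Finsupp.sum, map_sum]
  have h1 : ∀ la, coeff (Finsupp.sumElim a b) (expTerm la) = algebraMap QT QTSeries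
      (kernelCoeff b la * coeff a (pMulti QT (stdAlphabet n) la)) := fun la => by
    rw [coeff_expTerm, kernelCoeff_apply]
    congr 1
    ring
  simp only [h1]
  refine hasSum_sum_of_ne_finset_zero fun la hla => ?_
  rw [Finsupp.notMem_support_iff.1 hla, zero_mul, map_zero]

theorem scalar_comm (f g : MultiSym n) : scalar f g = scalar g f := by
  classical
  unfold scalar
  rw [Finsupp.sum_of_support_subset f subset_union_left _ (by simp),
    Finsupp.sum_of_support_subset g (subset_union_right (s₁ := f.support)) _ (by simp)]
  exact sum_congr rfl fun la _ => by ring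

theorem scalar_kernelCoeff (b : Fin n × ℕ →₀ ℕ) (f : MultiSym n) :
    scalar (kernelCoeff b) f = coeff b (f.eval QT (stdAlphabet n)) := by
  rw [scalar_comm, coeff_eval, scalar]
  refine Finsupp.sum_congr fun la _ => ?_
  rw [kernelCoeff_apply]
  field_simp [zNorm_ne_zero la]

theorem isReproducingKernel_kernel (hn : 1 ≤ n) : IsReproducingKernel (kernel n) := fun b =>
  ⟨kernelCoeff b, fun a => coeff_kernel hn a b, scalar_kernelCoeff b⟩

end Reproducing

/-! ### Orthogonal bases -/

section Orthogonal

open MvPowerSeries Finset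

/-- The form as a linear map in its first argument. -/
def scalarLeft (g : MultiSym n) : MultiSym n →ₗ[QT] QT :=
  Finsupp.linearCombination QT fun la => g la * zNorm la

theorem scalarLeft_apply (f g : MultiSym n) : scalarLeft g f = scalar f g := by
  rw [scalarLeft, Finsupp.linearCombination_apply, scalar]
  exact Finsupp.sum_congr fun la _ => by rw [smul_eq_mul, mul_assoc]

theorem scalar_eq_repr {P : Module.Basis (MultiPtn n) QT (MultiSym n)}
    (hP : ∀ la mu, la ≠ mu → scalar (P la) (P mu) = 0) (f : MultiSym n) (la : MultiPtn n) :
    scalar f (P la) = P.repr f la * scalar (P la) (P la) := by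
  conv_lhs => rw [← P.linearCombination_repr f]
  rw [← scalarLeft_apply, Finsupp.linearCombination_apply, Finsupp.sum, map_sum]
  simp only [map_smul, scalarLeft_apply, smul_eq_mul]
  refine sum_eq_single la (fun mu _ hmu => by rw [hP mu la hmu, mul_zero]) fun h => ?_
  rw [Finsupp.notMem_support_iff.1 h, zero_mul]

/-- The form is nondegenerate: if the norm vanished, the basis vector would be orthogonal to every
power sum, and its coordinates would vanish since `zNorm` does not. -/
theorem scalar_self_ne_zero {P : Module.Basis (MultiPtn n) QT (MultiSym n)}
    (hP : ∀ la mu, la ≠ mu → scalar (P la) (P mu) = 0) (la : MultiPtn n) :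
    scalar (P la) (P la) ≠ 0 := by
  intro h
  refine P.ne_zero la (Finsupp.ext fun mu => ?_)
  have h1 := scalar_eq_repr hP (Finsupp.single mu 1) la
  rw [h, mul_zero, scalar, Finsupp.sum_single_index (by simp), one_mul] at h1
  exact (mul_eq_zero.1 h1).resolve_right (zNorm_ne_zero mu)

/-- The coordinate of `kernelCoeff b` along `P la` is its pairing with `P la` over the norm, and by
the reproducing property that pairing is the y^b-coefficient of `P la`. For fixed exponents only
finitely many terms survive. -/
theorem hasSum_kernel_orthogonal (hn : 1 ≤ n) {P : Module.Basis (MultiPtn n) QT (MultiSym n)}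
    (hP : ∀ la mu, la ≠ mu → scalar (P la) (P mu) = 0) :
    HasSum (fun la : MultiPtn n => (scalar (P la) (P la))⁻¹ •
      ((P la).eval QTSeries (xAlphabet n) * (P la).eval QTSeries (yAlphabet n))) (kernel n) := by
  refine WithPiTopology.hasSum_iff_hasSum_coeff.2 fun e => ?_
  obtain ⟨a, b, rfl⟩ : ∃ a b, e = Finsupp.sumElim a b :=
    ⟨_, _, (Finsupp.comapDomain_sumElim_comapDomain e).symm⟩
  have h1 : ∀ la, coeff (Finsupp.sumElim a b) ((scalar (P la) (P la))⁻¹ •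
      ((P la).eval QTSeries (xAlphabet n) * (P la).eval QTSeries (yAlphabet n))) =
      algebraMap QT QTSeries
        (P.repr (kernelCoeff b) la * coeff a ((P la).eval QT (stdAlphabet n))) := fun la => by
    rw [coeff_qt_smul, coeff_eval_mul_eval, ← map_mul, ← scalar_kernelCoeff b,
      scalar_eq_repr hP (kernelCoeff b)]
    congr 1
    field_simp [scalar_self_ne_zero hP la]
  have h2 : coeff a ((kernelCoeff b).eval QT (stdAlphabet n)) =
      ∑ la ∈ (P.repr (kernelCoeff b)).support,
        P.repr (kernelCoeff b) la * coeff a ((P la).eval QT (stdAlphabet n)) := by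
    -- Extracting the coefficient at `a` is pairing with `kernelCoeff a`, hence a linear functional.
    simp only [← scalar_kernelCoeff a, scalar_comm (kernelCoeff a), ← scalarLeft_apply]
    conv_lhs => rw [← P.linearCombination_repr (kernelCoeff b)]
    rw [Finsupp.linearCombination_apply, Finsupp.sum, map_sum]
    simp only [map_smul, smul_eq_mul]
  rw [coeff_kernel hn, h2, map_sum]
  simp only [h1]
  refine hasSum_sum_of_ne_finset_zero fun la hla => ?_
  rw [Finsupp.notMem_support_iff.1 hla, zero_mul, map_zero]

end Orthogonal

end

end MultiMacdonald

open MultiMacdonald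
theorem mainTheorem6 (n : ℕ) (hn : 1 ≤ n) :
    KernelConverges n ∧
    HasSum (fun la : MultiPtn n => (zNorm la)⁻¹ •
      (pMulti QTSeries (xAlphabet n) la * pMulti QTSeries (yAlphabet n) la)) (kernel n) ∧
    IsReproducingKernel (kernel n) ∧
    ∀ P : Module.Basis (MultiPtn n) QT (MultiSym n), IsMultiMacdonald P →
      (∀ la : MultiPtn n, scalar (P la) (P la) ≠ 0) ∧
      HasSum (fun la : MultiPtn n => (scalar (P la) (P la))⁻¹ •
        ((P la).eval QTSeries (xAlphabet n) * (P la).eval QTSeries (yAlphabet n)))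
        (kernel n) :=
  ⟨kernelConverges hn, hasSum_kernel hn, isReproducingKernel_kernel hn, fun _ hP =>
    ⟨scalar_self_ne_zero hP.orthogonal, hasSum_kernel_orthogonal hn hP.orthogonal⟩⟩
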